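/- Let $L_A$ be the first-order language with constants $0,1$, binary function symbols $+,\times$ and a binary relation symbol $\le$. Let $\mathsf{PA}$ be the $L_A$-theory with the axioms $\forall x\,(x+1\neq 0)$; $\forall x\forall y\,(x+1=y+1\Rightarrow x=y)$; $\forall x\,(x+0=x)$; $\forall x\forall y\,(x+(y+1)=(x+y)+1)$; $\forall x\,(x\times 0=0)$; $\forall x\forall y\,(x\times(y+1)=(x\times y)+x)$; $\forall x\forall y\,(x\le y\Leftrightarrow\exists z\,(x+z=y))$; and the universal closure of $$(\varphi(0)\wedge\forall x(\varphi(x)\Rightarrow\varphi(x+1)))\Rightarrow\forall x\,\varphi(x)$$ for every $L_A$-formula $\varphi(x)$, possibly with parameters. A model $\mathcal M$ of $\mathsf{PA}$ is non-standard if it is not isomorphic, as an $L_A$-structure, to the standard model $\langle\mathbb N,+,\times,\le,0,1\rangle$. A natural number $n$ is interpreted in $\mathcal M$ by its numeral $(\cdots(0+1)+\cdots)+1$. The standard system $\mathsf{SSy}(\mathcal M)$ is the set of all $A\subseteq\mathbb N$ of the form $A=\{n\in\mathbb N:\mathcal M\vDash\varphi(n,c)\}$ with $\varphi$ an $L_A$-formula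 in two free variables and $c\in\mathcal M$. **Theorem 7.** Let $\mathcal M$ be a non-standard model of $\mathsf{PA}$. Then $\mathsf{SSy}(\mathcal M)$ contains a non-recursive set $C$. Moreover, $C$ can be chosen to be coded through prime divisors by a single element of $\mathcal M$: there is $c\in\mathcal M$ with $$C=\{n\in\mathbb N:\mathcal M\vDash\exists k\,(c=k\times\pi_n)\},$$ where $\pi_0=2,\pi_1=3,\dots$ are the primes in increasing order. -/

import Mathlib

open FirstOrder FirstOrder.Language

namespace PeanoArithmetic

/-- Function symbols of the language of arithmetic: the constants `0`, `1` and binary `+`, `×`. -/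
inductive ArithFunc : ℕ → Type
  | zero : ArithFunc 0
  | one : ArithFunc 0
  | add : ArithFunc 2
  | mul : ArithFunc 2

/-- The only relation symbol of the language of arithmetic: binary `≤`. -/
inductive ArithRel : ℕ → Type
  | le : ArithRel 2

/-- The first-order language of arithmetic `{0, 1, +, ×, ≤}`. -/
def LA : Language where
  Functions := ArithFunc
  Relations := ArithRel

section Terms

variable {α : Type*}

instance : Zero (LA.Term α) := ⟨Constants.term (L := LA) ArithFunc.zero⟩
instance : One (LA.Term α) := ⟨Constants.term (L := LA) ArithFunc.one⟩
instance : Add (LA.Term α) := ⟨Functions.apply₂ (L := LA) ArithFunc.add⟩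
instance : Mul (LA.Term α) := ⟨Functions.apply₂ (L := LA) ArithFunc.mul⟩

/-- The numeral of `n`, that is, the closed term `(⋯((0 + 1) + 1) + ⋯) + 1` with `n` ones. -/
def numeral : ℕ → LA.Term α
  | 0 => 0
  | n + 1 => numeral n + 1

end Terms

/-- The standard model `⟨ℕ, +, ×, ≤, 0, 1⟩`. -/
instance standardModel : LA.Structure ℕ where
  funMap
    | ArithFunc.zero, _ => 0
    | ArithFunc.one, _ => 1
    | ArithFunc.add, v => v 0 + v 1
    | ArithFunc.mul, v => v 0 * v 1
  RelMap
    | ArithRel.le, v => v 0 ≤ v 1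

/-- `∀ x, x + 1 ≠ 0`. -/
def succNeZero : LA.Sentence := ∀' ∼((&0 + 1) =' 0)

/-- `∀ x y, x + 1 = y + 1 → x = y`. -/
def succInj : LA.Sentence := ∀' ∀' (((&0 + 1) =' (&1 + 1)) ⟹ (&0 =' &1))

/-- `∀ x, x + 0 = x`. -/
def addZero : LA.Sentence := ∀' ((&0 + 0) =' &0)

/-- `∀ x y, x + (y + 1) = (x + y) + 1`. -/
def addSucc : LA.Sentence := ∀' ∀' ((&0 + (&1 + 1)) =' ((&0 + &1) + 1))

/-- `∀ x, x × 0 = 0`. -/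
def mulZero : LA.Sentence := ∀' ((&0 * 0) =' 0)

/-- `∀ x y, x × (y + 1) = (x × y) + x`. -/
def mulSucc : LA.Sentence := ∀' ∀' ((&0 * (&1 + 1)) =' ((&0 * &1) + &0))

/-- The definition of the order: `∀ x y, x ≤ y ↔ ∃ z, x + z = y`. -/
def leDef : LA.Sentence :=
  ∀' ∀' ((Relations.boundedFormula₂ (L := LA) ArithRel.le &0 &1) ⇔ ∃' ((&0 + &2) =' &1))

/-- The induction axiom for a formula `φ(p, x)` with parameters `p = (p₁, …, pₙ)`:
`∀ p, (φ(p, 0) ∧ ∀ x, (φ(p, x) → φ(p, x + 1))) → ∀ x, φ(p, x)`. -/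
noncomputable def induction {n : ℕ} (φ : LA.Formula (Fin n ⊕ Fin 1)) : LA.Sentence :=
  let φ₀ : LA.Formula (Fin n) :=
    BoundedFormula.subst φ (Sum.elim (fun i => Term.var i) (fun _ => 0))
  let φ₁ : LA.Formula (Fin n ⊕ Fin 1) :=
    BoundedFormula.subst φ
      (Sum.elim (fun i => Term.var (Sum.inl i)) (fun j => Term.var (Sum.inr j) + 1))
  let body : LA.Formula (Fin n) :=
    (φ₀ ⊓ Formula.iAlls (Fin 1) (φ.imp φ₁)).imp (Formula.iAlls (Fin 1) φ)
  Formula.iAlls (Fin n) (Formula.relabel (Sum.inr : Fin n → Empty ⊕ Fin n) body)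

/-- First-order Peano arithmetic. -/
def PA : LA.Theory :=
  {succNeZero, succInj, addZero, addSucc, mulZero, mulSucc, leDef} ∪
    {σ | ∃ (n : ℕ) (φ : LA.Formula (Fin n ⊕ Fin 1)), σ = induction φ}

section Models

variable (M : Type*) [LA.Structure M]

/-- A non-standard model of `PA`: a model of `PA` that is not isomorphic, as a structure for the
language of arithmetic, to the standard model. -/
def IsNonstandardModel : Prop :=
  M ⊨ PA ∧ IsEmpty (LA.Equiv ℕ M)

variable {M} in
/-- `M ⊨ φ(n, c)` for a formula `φ` in two free variables, a natural number `n` (standing for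
the element of `M` that its numeral denotes) and `c ∈ M`. -/
def Satisfies (φ : LA.Formula (Fin 2)) (n : ℕ) (c : M) : Prop :=
  φ.Realize ![(numeral n : LA.Term Empty).realize Empty.elim, c]

/-- The standard system of `M`: all sets `{n ∈ ℕ : M ⊨ φ(n, c)}` with `φ` a formula of the
language of arithmetic and `c ∈ M`. -/
def SSy : Set (Set ℕ) :=
  {A | ∃ (φ : LA.Formula (Fin 2)) (c : M), A = {n | Satisfies φ n c}}

/-- The formula `∃ k, c = k × p` in the free variables `p` (number 0) and `c` (number 1). -/
def dividesFormula : LA.Formula (Fin 2) :=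
  ∃' ((Term.var (Sum.inl 1)) =' (&0 * Term.var (Sum.inl 0)) : LA.BoundedFormula (Fin 2) 1)

variable {M} in
/-- The set coded by `c ∈ M` through prime divisors: `{n ∈ ℕ : M ⊨ ∃ k, c = k × πₙ}`, where
`π₀ = 2, π₁ = 3, …` are the primes in increasing order. -/
def codedSet (c : M) : Set ℕ :=
  {n | Satisfies dividesFormula (Nat.nth Nat.Prime n) c}

end Models

end PeanoArithmetic

/-!
Let `b` be an element of the non-standard model `M` above all standard elements, which exists
because the standard elements form an initial segment isomorphic to `ℕ`, which is therefore not all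
of `M`.

*A non-recursive definable set.* Every primitive recursive function is representable in `M`
(`Representable.of_primrec`): primitive recursion is expressed with Gödel's `β` function, and the
quantifiers that matter range over standard elements only. Let `A` and `B` be the sets of programs
that halt on their own code with value `0` and `1` respectively. They have the form
`{n | ∃ z, T (n, z) = 1}` and `{n | ∃ z, T (n, z) = 2}` for a primitive recursive `T`, and no
recursive set separates them (`exists_primrec_inseparable`). Rosser's formula "there is a stage `z`
with `T (n, z) = 1` such that `T (n, w) ≠ 2` for all `w ≤ z`" defines in `M` a set that contains `A`
and avoids `B` (`exists_separating_formula`). Its standard part `C`, that is, the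
set of `n : ℕ` whose numerals satisfy the formula, is in the standard system and is not recursive.

*The code.* By induction on `k` inside `M`, for every definable property `P` and every `k` there is
`c` whose prime divisors are exactly the primes `p < k` with `P p` (`exists_prime_dvd_iff`). For
`k = b` the bound is void for standard primes, which remain prime in `M` (`prime_natCast`). As the
function counting the primes below its argument is primitive recursive and sends `πₙ` to `n`, the
property `P` can be chosen to hold at `πₙ` exactly when `n ∈ C` (`exists_prime_code`).

Definability is handled through `IsArith`: a predicate on assignments `v : ℕ → M` of values to
variables is arithmetical if some formula has it as its truth set. Closure lemmas, one for each
connective and quantifier, then take the place of writing formulas down.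
-/

namespace PeanoArithmetic

/-! ### Recursively inseparable sets and prime counting -/

section Computability

open Nat.Partrec (Code)

/-- The matrix of a pair of recursively inseparable sets. Here `T (pair n z)` is the
outcome, shifted by one, of running the `n`-th program on the input `n` with step bound `z`, and `0`
if it has not halted.
The sets `{n | ∃ z, T (pair n z) = 1}` and `{n | ∃ z, T (pair n z) = 2}` of programs that return `0`
and `1` on themselves are disjoint, and the indicator function of a separating set, being different
on `n` from the `n`-th program, is not computable. -/
theorem exists_primrec_inseparable : ∃ T : ℕ → ℕ, Nat.Primrec T ∧
    (∀ n z w, T (Nat.pair n z) = 1 → T (Nat.pair n w) ≠ 2) ∧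
    ∀ C : Set ℕ, (∀ n z, T (Nat.pair n z) = 1 → n ∈ C) →
      (∀ n z, T (Nat.pair n z) = 2 → n ∉ C) → ¬ ComputablePred fun n : ℕ => n ∈ C := by
  set T : ℕ → ℕ := fun q => Encodable.encode
    (Code.evaln q.unpair.2 (Denumerable.ofNat Code q.unpair.1) q.unpair.1) with hT
  have hval : ∀ n z a, T (Nat.pair n z) = a + 1 ↔
      a ∈ Code.evaln z (Denumerable.ofNat Code n) n := by
    intro n z a
    simp only [hT, Nat.unpair_pair]
    cases Code.evaln z (Denumerable.ofNat Code n) n <;> simp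
  refine ⟨T, ?_, fun n z w hz hw => ?_, fun C h₁ h₂ => ?_⟩
  · have hl : Primrec fun q : ℕ => q.unpair.1 := Primrec.fst.comp Primrec.unpair
    have hr : Primrec fun q : ℕ => q.unpair.2 := Primrec.snd.comp Primrec.unpair
    exact Primrec.nat_iff.1 (Primrec.encode.comp (Code.primrec_evaln.comp
      ((hr.pair ((Primrec.ofNat Code).comp hl)).pair hl)))
  · have e := Part.mem_unique (Code.evaln_sound ((hval n z 0).1 hz))
      (Code.evaln_sound ((hval n w 1).1 hw))
    exact absurd e (by decide)
  · rintro ⟨hdec, hC⟩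
    have hg : Computable fun n : ℕ => bif decide (n ∈ C) then 1 else 0 :=
      Computable.cond hC (Computable.const 1) (Computable.const 0)
    obtain ⟨c, hc⟩ := Code.exists_code.1 (Partrec.nat_iff.1 hg.partrec)
    have hmem : ∀ a, a ∈ Code.eval c (Encodable.encode c) →
        ∃ z, T (Nat.pair (Encodable.encode c) z) = a + 1 := fun a ha => by
      obtain ⟨z, hz⟩ := Code.evaln_complete.1 ha
      exact ⟨z, (hval _ _ _).2 (by rwa [Denumerable.ofNat_encode])⟩
    rw [hc] at hmem
    -- `c` computes the indicator function of `C`; its own code refutes that `C` separates.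
    by_cases h : Encodable.encode c ∈ C
    · obtain ⟨z, hz⟩ := hmem 1 (by simp [h])
      exact h₂ _ z hz h
    · obtain ⟨z, hz⟩ := hmem 0 (by simp [h])
      exact h (h₁ _ z hz)

/-- The prime counting function is primitive recursive. It maps the prime `πₙ` back to its index
`n`, which makes the enumeration of the primes itself unnecessary. -/
theorem primrec_count_prime : Nat.Primrec (Nat.count Nat.Prime) := by
  have hdvd : PrimrecRel fun x n : ℕ => x ∣ n :=
    (PrimrecRel.comp Primrec.eq (Primrec.nat_mod.comp Primrec.snd Primrec.fst)
      (Primrec.const 0)).of_eq fun p => (Nat.dvd_iff_mod_eq_zero).symm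
  have hR : PrimrecRel fun x n : ℕ => x ∣ n → x = 1 := by
    have := hdvd.not.or (PrimrecRel.comp Primrec.eq Primrec.fst (Primrec.const 1))
    exact this.of_eq fun p => by tauto
  have hp : PrimrecPred Nat.Prime := by
    have h := (PrimrecRel.comp Primrec.nat_le (Primrec.const 2) Primrec.id).and
      ((PrimrecRel.forall_lt hR).comp Primrec.id Primrec.id)
    exact h.of_eq fun n => Nat.prime_def_lt.symm
  have hs : Primrec₂ fun n IH : ℕ => IH + if n.Prime then 1 else 0 :=
    Primrec.nat_add.comp Primrec.snd
      (Primrec.ite (hp.comp Primrec.fst) (Primrec.const 1) (Primrec.const 0))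
  refine Primrec.nat_iff.1 ((Primrec.nat_rec₁ 0 hs).of_eq fun n => ?_)
  induction n with
  | zero => simp
  | succ n ih => rw [Nat.count_succ, ← ih]

end Computability

/-! ### Definability by formulas -/

section Definability

variable {M : Type*} [LA.Structure M]

/-- A predicate on assignments `v : ℕ → M` is arithmetical if it is the truth set of a formula
without parameters whose free variables are indexed by `ℕ`. -/
def IsArith (P : (ℕ → M) → Prop) : Prop :=
  ∃ φ : LA.Formula ℕ, ∀ v, φ.Realize v ↔ P v

/-- A function on assignments `v : ℕ → M` is given by a term if it is the value of a term of the
language of arithmetic without parameters. -/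
def IsArithTerm (t : (ℕ → M) → M) : Prop :=
  ∃ s : LA.Term ℕ, ∀ v, s.realize v = t v

namespace IsArithTerm

theorem var (k : ℕ) : IsArithTerm fun v : ℕ → M => v k := ⟨Term.var k, fun _ => rfl⟩

end IsArithTerm

namespace IsArith

theorem eq {s t : (ℕ → M) → M} : IsArithTerm s → IsArithTerm t → IsArith fun v => s v = t v
  | ⟨a, ha⟩, ⟨b, hb⟩ => ⟨a.equal b, fun v => by rw [Formula.realize_equal, ha, hb]⟩

theorem not {P : (ℕ → M) → Prop} : IsArith P → IsArith fun v => ¬ P v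
  | ⟨φ, h⟩ => ⟨φ.not, fun v => by rw [Formula.realize_not, h]⟩

theorem and {P Q : (ℕ → M) → Prop} : IsArith P → IsArith Q → IsArith fun v => P v ∧ Q v
  | ⟨φ, h⟩, ⟨ψ, h'⟩ => ⟨φ ⊓ ψ, fun v => by rw [Formula.realize_inf, h, h']⟩

theorem or {P Q : (ℕ → M) → Prop} : IsArith P → IsArith Q → IsArith fun v => P v ∨ Q v
  | ⟨φ, h⟩, ⟨ψ, h'⟩ => ⟨φ ⊔ ψ, fun v => by rw [Formula.realize_sup, h, h']⟩

theorem imp {P Q : (ℕ → M) → Prop} : IsArith P → IsArith Q → IsArith fun v => P v → Q v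
  | ⟨φ, h⟩, ⟨ψ, h'⟩ => ⟨φ.imp ψ, fun v => by rw [Formula.realize_imp, h, h']⟩

theorem iff {P Q : (ℕ → M) → Prop} : IsArith P → IsArith Q → IsArith fun v => (P v ↔ Q v)
  | ⟨φ, h⟩, ⟨ψ, h'⟩ => ⟨φ.iff ψ, fun v => by rw [Formula.realize_iff, h, h']⟩

/-- Quantification binds variable `0` and shifts the other variables down, in de Bruijn style. -/
theorem all {Q : M → (ℕ → M) → Prop} :
    (IsArith fun w : ℕ → M => Q (w 0) fun i => w (i + 1)) → IsArith fun v => ∀ x, Q x v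
  | ⟨φ, h⟩ => by
    refine ⟨Formula.iAlls (Fin 1) (Formula.relabel
      (fun i : ℕ => Nat.casesOn i (Sum.inr 0) Sum.inl : ℕ → ℕ ⊕ Fin 1) φ), fun v => ?_⟩
    simp only [Formula.realize_iAlls, Formula.realize_relabel, h]
    exact ⟨fun H x => H fun _ => x, fun H x => H (x 0)⟩

/-- Quantification binds variable `0` and shifts the other variables down, in de Bruijn style. -/
theorem ex {Q : M → (ℕ → M) → Prop}
    (h : IsArith fun w : ℕ → M => Q (w 0) fun i => w (i + 1)) : IsArith fun v => ∃ x, Q x v := by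
  simpa only [not_forall, not_not] using (all (Q := fun x v => ¬ Q x v) h.not).not

/-- Substitution of terms into an arithmetical relation. -/
theorem subst {P : (ℕ → M) → Prop} (hP : IsArith P) {t : ℕ → (ℕ → M) → M}
    (ht : ∀ i, IsArithTerm (t i)) : IsArith fun v => P fun i => t i v := by
  obtain ⟨φ, h⟩ := hP
  choose s hs using ht
  refine ⟨BoundedFormula.subst φ s, fun v => ?_⟩
  rw [Formula.Realize, BoundedFormula.realize_subst]
  simp only [hs]
  exact h _

theorem subst₁ {R : M → Prop} (hR : IsArith fun v : ℕ → M => R (v 0)) {s : (ℕ → M) → M}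
    (hs : IsArithTerm s) : IsArith fun v => R (s v) :=
  hR.subst (t := fun _ => s) fun _ => hs

theorem subst₂ {R : M → M → Prop} (hR : IsArith fun v : ℕ → M => R (v 0) (v 1))
    {s t : (ℕ → M) → M} (hs : IsArithTerm s) (ht : IsArithTerm t) :
    IsArith fun v => R (s v) (t v) :=
  hR.subst (t := fun i => Nat.casesOn i s fun _ => t) fun i => by cases i <;> assumption

end IsArith

end Definability

/-! ### The axioms in a model -/

section Interpretation

variable {M : Type*} [LA.Structure M] [M ⊨ PA]

/-- The zero of a model of `PA`, denoted by the constant `0`. The argument `M ⊨ PA`, here and in the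
following instances, keeps them from competing with the usual operations on `ℕ`, which is an
`LA`-structure as well. -/
abbrev zeroOfModel (M : Type*) [LA.Structure M] [M ⊨ PA] : Zero M :=
  ⟨Structure.funMap (L := LA) ArithFunc.zero ![]⟩

/-- The one of a model of `PA`, denoted by the constant `1`. -/
abbrev oneOfModel (M : Type*) [LA.Structure M] [M ⊨ PA] : One M :=
  ⟨Structure.funMap (L := LA) ArithFunc.one ![]⟩

/-- The addition of a model of `PA`. -/
abbrev addOfModel (M : Type*) [LA.Structure M] [M ⊨ PA] : Add M :=
  ⟨fun x y => Structure.funMap (L := LA) ArithFunc.add ![x, y]⟩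

/-- The multiplication of a model of `PA`. -/
abbrev mulOfModel (M : Type*) [LA.Structure M] [M ⊨ PA] : Mul M :=
  ⟨fun x y => Structure.funMap (L := LA) ArithFunc.mul ![x, y]⟩

/-- The order relation of a model of `PA`. -/
abbrev leOfModel (M : Type*) [LA.Structure M] [M ⊨ PA] : LE M :=
  ⟨fun x y => Structure.RelMap (L := LA) ArithRel.le ![x, y]⟩

attribute [local instance] zeroOfModel oneOfModel addOfModel mulOfModel leOfModel

theorem realize_zero {α : Type*} (v : α → M) : (0 : LA.Term α).realize v = 0 :=
  congrArg (Structure.funMap (L := LA) ArithFunc.zero) (Subsingleton.elim _ _)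

theorem realize_one {α : Type*} (v : α → M) : (1 : LA.Term α).realize v = 1 :=
  congrArg (Structure.funMap (L := LA) ArithFunc.one) (Subsingleton.elim _ _)

theorem realize_add {α : Type*} (s t : LA.Term α) (v : α → M) :
    (s + t).realize v = s.realize v + t.realize v :=
  Term.realize_functions_apply₂

theorem realize_mul {α : Type*} (s t : LA.Term α) (v : α → M) :
    (s * t).realize v = s.realize v * t.realize v :=
  Term.realize_functions_apply₂

theorem realize_of_mem_PA {σ : LA.Sentence} (h : σ ∈ PA) : M ⊨ σ :=
  Theory.realize_sentence_of_mem PA h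

theorem model_succ_ne_zero (x : M) : x + 1 ≠ 0 := by
  have h : M ⊨ succNeZero := realize_of_mem_PA (by simp [PA])
  simp only [succNeZero, Sentence.Realize, Formula.Realize, BoundedFormula.realize_all,
    BoundedFormula.realize_not, BoundedFormula.realize_bdEqual, realize_add, realize_one,
    realize_zero] at h
  exact h x

theorem model_succ_inj (x y : M) (hxy : x + 1 = y + 1) : x = y := by
  have h : M ⊨ succInj := realize_of_mem_PA (by simp [PA])
  simp only [succInj, Sentence.Realize, Formula.Realize, BoundedFormula.realize_all,
    BoundedFormula.realize_imp, BoundedFormula.realize_bdEqual, realize_add, realize_one] at h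
  exact h x y hxy

theorem model_add_zero (x : M) : x + 0 = x := by
  have h : M ⊨ addZero := realize_of_mem_PA (by simp [PA])
  simp only [addZero, Sentence.Realize, Formula.Realize, BoundedFormula.realize_all,
    BoundedFormula.realize_bdEqual, realize_add, realize_zero] at h
  exact h x

theorem model_add_succ (x y : M) : x + (y + 1) = x + y + 1 := by
  have h : M ⊨ addSucc := realize_of_mem_PA (by simp [PA])
  simp only [addSucc, Sentence.Realize, Formula.Realize, BoundedFormula.realize_all,
    BoundedFormula.realize_bdEqual, realize_add, realize_one] at h
  exact h x y

theorem model_mul_zero (x : M) : x * 0 = 0 := by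
  have h : M ⊨ mulZero := realize_of_mem_PA (by simp [PA])
  simp only [mulZero, Sentence.Realize, Formula.Realize, BoundedFormula.realize_all,
    BoundedFormula.realize_bdEqual, realize_mul, realize_zero] at h
  exact h x

theorem model_mul_succ (x y : M) : x * (y + 1) = x * y + x := by
  have h : M ⊨ mulSucc := realize_of_mem_PA (by simp [PA])
  simp only [mulSucc, Sentence.Realize, Formula.Realize, BoundedFormula.realize_all,
    BoundedFormula.realize_bdEqual, realize_add, realize_mul, realize_one] at h
  exact h x y

theorem model_le_iff (x y : M) : x ≤ y ↔ ∃ z, x + z = y := by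
  have h : M ⊨ leDef := realize_of_mem_PA (by simp [PA])
  simp only [leDef, Sentence.Realize, Formula.Realize, BoundedFormula.realize_all,
    BoundedFormula.realize_iff, BoundedFormula.realize_ex, BoundedFormula.realize_bdEqual,
    realize_add] at h
  exact (BoundedFormula.realize_rel₂ (L := LA) (R := ArithRel.le)).symm.trans (h x y)

/-! ### Arithmetical predicates and induction -/

theorem IsArithTerm.zero : IsArithTerm fun _ : ℕ → M => 0 := ⟨0, realize_zero⟩

theorem IsArithTerm.one : IsArithTerm fun _ : ℕ → M => 1 := ⟨1, realize_one⟩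

theorem IsArithTerm.add {s t : (ℕ → M) → M} : IsArithTerm s → IsArithTerm t →
    IsArithTerm fun v => s v + t v
  | ⟨a, ha⟩, ⟨b, hb⟩ => ⟨a + b, fun v => by rw [realize_add, ha, hb]⟩

theorem IsArithTerm.mul {s t : (ℕ → M) → M} : IsArithTerm s → IsArithTerm t →
    IsArithTerm fun v => s v * t v
  | ⟨a, ha⟩, ⟨b, hb⟩ => ⟨a * b, fun v => by rw [realize_mul, ha, hb]⟩

theorem IsArith.le {s t : (ℕ → M) → M} : IsArithTerm s → IsArithTerm t → IsArith fun v => s v ≤ t v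
  | ⟨a, ha⟩, ⟨b, hb⟩ =>
    ⟨Relations.formula₂ (L := LA) ArithRel.le a b, fun v =>
      (Formula.realize_rel₂ (L := LA) (R := ArithRel.le)).trans (by rw [ha, hb]; rfl)⟩

/-- Induction in a model of `PA`, for properties definable without parameters. Parameters are not
needed if they are quantified universally inside the property. -/
theorem arith_induction {P : M → Prop} (hP : IsArith fun v : ℕ → M => P (v 0)) (zero : P 0)
    (succ : ∀ x, P x → P (x + 1)) (x : M) : P x := by
  obtain ⟨φ, h⟩ := hP
  set ψ : LA.Formula (Fin 0 ⊕ Fin 1) := Formula.relabel (fun _ => Sum.inr 0) φ with hψ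
  have hr : ∀ w : Fin 0 ⊕ Fin 1 → M, BoundedFormula.Realize ψ w default ↔ P (w (Sum.inr 0)) :=
    fun w => by
      rw [hψ, ← Formula.Realize, Formula.realize_relabel, h]; rfl
  have H : M ⊨ induction ψ := realize_of_mem_PA (Or.inr ⟨0, ψ, rfl⟩)
  simp only [induction, Sentence.Realize, Formula.realize_iAlls, Formula.realize_relabel,
    Formula.realize_imp, Formula.realize_inf] at H
  simp only [Formula.Realize, BoundedFormula.realize_subst, hr] at H
  refine H Fin.elim0 ⟨?_, fun y hy => ?_⟩ fun _ => x
  · simpa only [Sum.elim_inr, realize_zero] using zero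
  · simp only [Sum.elim_inr, realize_add, realize_one, Term.realize_var]
    exact succ _ hy

/-! ### The ordered semiring structure of a model -/

theorem model_zero_add (x : M) : 0 + x = x :=
  arith_induction (P := fun x : M => 0 + x = x) (.eq (.add .zero (.var 0)) (.var 0))
    (model_add_zero 0) (fun x hx => by rw [model_add_succ, hx]) x

theorem model_succ_add (x y : M) : x + 1 + y = x + y + 1 :=
  arith_induction (P := fun y : M => ∀ x : M, x + 1 + y = x + y + 1)
    (.all (.eq (.add (.add (.var 0) .one) (.var 1)) (.add (.add (.var 0) (.var 1)) .one)))
    (fun x => by rw [model_add_zero, model_add_zero])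
    (fun y hy x => by rw [model_add_succ, hy, model_add_succ]) y x

theorem model_add_comm (x y : M) : x + y = y + x :=
  arith_induction (P := fun y : M => ∀ x : M, x + y = y + x)
    (.all (.eq (.add (.var 0) (.var 1)) (.add (.var 1) (.var 0))))
    (fun x => by rw [model_add_zero, model_zero_add])
    (fun y hy x => by rw [model_add_succ, hy, model_succ_add]) y x

theorem model_add_assoc (x y z : M) : x + y + z = x + (y + z) :=
  arith_induction (P := fun z : M => ∀ x y : M, x + y + z = x + (y + z))
    (.all (.all (.eq (.add (.add (.var 1) (.var 0)) (.var 2))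
      (.add (.var 1) (.add (.var 0) (.var 2))))))
    (fun x y => by rw [model_add_zero, model_add_zero])
    (fun z hz x y => by rw [model_add_succ, hz, model_add_succ, model_add_succ]) z x y

theorem model_zero_mul (x : M) : 0 * x = 0 :=
  arith_induction (P := fun x : M => 0 * x = 0) (.eq (.mul .zero (.var 0)) .zero)
    (model_mul_zero 0)
    (fun x hx => by rw [model_mul_succ, hx, model_add_zero]) x

theorem model_succ_mul (x y : M) : (x + 1) * y = x * y + y :=
  arith_induction (P := fun y : M => ∀ x : M, (x + 1) * y = x * y + y)
    (.all (.eq (.mul (.add (.var 0) .one) (.var 1)) (.add (.mul (.var 0) (.var 1)) (.var 1))))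
    (fun x => by simp only [model_add_zero, model_mul_zero])
    (fun y hy x => by
      rw [model_mul_succ, hy, model_mul_succ, model_add_assoc, model_add_assoc,
        ← model_add_assoc y, ← model_add_assoc x, model_add_comm y x]) y x

theorem model_mul_comm (x y : M) : x * y = y * x :=
  arith_induction (P := fun y : M => ∀ x : M, x * y = y * x)
    (.all (.eq (.mul (.var 0) (.var 1)) (.mul (.var 1) (.var 0))))
    (fun x => by rw [model_mul_zero, model_zero_mul])
    (fun y hy x => by rw [model_mul_succ, hy, model_succ_mul]) y x

theorem model_mul_add (x y z : M) : x * (y + z) = x * y + x * z :=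
  arith_induction (P := fun z : M => ∀ x y : M, x * (y + z) = x * y + x * z)
    (.all (.all (.eq (.mul (.var 1) (.add (.var 0) (.var 2)))
      (.add (.mul (.var 1) (.var 0)) (.mul (.var 1) (.var 2))))))
    (fun x y => by rw [model_add_zero, model_mul_zero, model_add_zero])
    (fun z hz x y => by
      rw [model_add_succ, model_mul_succ, hz, model_mul_succ, model_add_assoc]) z x y

theorem model_mul_assoc (x y z : M) : x * y * z = x * (y * z) :=
  arith_induction (P := fun z : M => ∀ x y : M, x * y * z = x * (y * z))
    (.all (.all (.eq (.mul (.mul (.var 1) (.var 0)) (.var 2))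
      (.mul (.var 1) (.mul (.var 0) (.var 2))))))
    (fun x y => by simp only [model_mul_zero])
    (fun z hz x y => by rw [model_mul_succ, hz, model_mul_succ, model_mul_add]) z x y

theorem model_mul_one (x : M) : x * 1 = x := by
  rw [← model_zero_add (1 : M), model_mul_succ, model_mul_zero, model_zero_add]

theorem model_add_right_cancel (x y z : M) : x + z = y + z → x = y :=
  arith_induction (P := fun z : M => ∀ x y : M, x + z = y + z → x = y)
    (.all (.all (.imp (.eq (.add (.var 1) (.var 2)) (.add (.var 0) (.var 2)))
      (.eq (.var 1) (.var 0)))))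
    (fun x y h => by rwa [model_add_zero, model_add_zero] at h)
    (fun z hz x y h => hz x y (model_succ_inj _ _ (by
      rwa [model_add_succ, model_add_succ] at h))) z x y

theorem model_eq_zero_or_succ (x : M) : x = 0 ∨ ∃ y, x = y + 1 :=
  arith_induction (P := fun x : M => x = 0 ∨ ∃ y, x = y + 1)
    (.or (.eq (.var 0) .zero) (.ex (.eq (.var 1) (.add (.var 0) .one))))
    (Or.inl rfl) (fun x _ => Or.inr ⟨x, rfl⟩) x

/-- A model of `PA` is a commutative semiring. -/
noncomputable abbrev commSemiringOfModel : CommSemiring M where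
  add_assoc := model_add_assoc
  zero_add := model_zero_add
  add_zero := model_add_zero
  add_comm := model_add_comm
  nsmul := nsmulRec
  mul_assoc := model_mul_assoc
  one_mul x := by rw [model_mul_comm, model_mul_one]
  mul_one := model_mul_one
  left_distrib := model_mul_add
  right_distrib x y z := by
    rw [model_mul_comm, model_mul_add, model_mul_comm z, model_mul_comm z]
  zero_mul := model_zero_mul
  mul_zero := model_mul_zero
  mul_comm := model_mul_comm

attribute [local instance] commSemiringOfModel

theorem model_eq_zero_of_add (x y : M) (h : x + y = 0) : y = 0 := by
  rcases model_eq_zero_or_succ y with hy | ⟨z, rfl⟩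
  · exact hy
  · exact absurd (by rw [← h, add_assoc]) (model_succ_ne_zero (x + z))

theorem model_le_total (x y : M) : x ≤ y ∨ y ≤ x := by
  simp only [model_le_iff]
  refine arith_induction (P := fun x : M => ∀ y : M, (∃ z, x + z = y) ∨ ∃ z, y + z = x)
    (.all (.or (.ex (.eq (.add (.var 2) (.var 0)) (.var 1)))
      (.ex (.eq (.add (.var 1) (.var 0)) (.var 2))))) ?_ ?_ x y
  · exact fun y => Or.inl ⟨y, zero_add y⟩
  · intro x hx y
    rcases hx y with ⟨z, rfl⟩ | ⟨z, rfl⟩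
    · rcases model_eq_zero_or_succ z with rfl | ⟨w, rfl⟩
      · exact Or.inr ⟨1, by ring⟩
      · exact Or.inl ⟨w, by ring⟩
    · exact Or.inr ⟨z + 1, by ring⟩

/-- The order of a model of `PA` is linear. -/
noncomputable abbrev linearOrderOfModel : LinearOrder M where
  le_refl x := (model_le_iff x x).2 ⟨0, add_zero x⟩
  le_trans x y z hxy hyz := by
    obtain ⟨a, rfl⟩ := (model_le_iff x y).1 hxy
    obtain ⟨b, rfl⟩ := (model_le_iff _ z).1 hyz
    exact (model_le_iff _ _).2 ⟨a + b, by ring⟩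
  le_antisymm x y hxy hyx := by
    obtain ⟨a, rfl⟩ := (model_le_iff x y).1 hxy
    obtain ⟨b, hb⟩ := (model_le_iff _ x).1 hyx
    have h : b + a = 0 := model_add_right_cancel _ _ x (by
      calc b + a + x = x + a + b := by ring
        _ = 0 + x := by rw [hb, zero_add])
    rw [model_eq_zero_of_add _ _ h, add_zero]
  le_total := model_le_total
  toDecidableLE := Classical.decRel _

attribute [local instance] linearOrderOfModel

theorem canonicallyOrderedAddOfModel : CanonicallyOrderedAdd M where
  exists_add_of_le {x y} h := by
    obtain ⟨z, hz⟩ := (model_le_iff x y).1 h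
    exact ⟨z, hz.symm⟩
  le_self_add x y := (model_le_iff _ _).2 ⟨y, rfl⟩
  le_add_self x y := (model_le_iff _ _).2 ⟨y, add_comm x y⟩

theorem isOrderedCancelAddMonoidOfModel : IsOrderedCancelAddMonoid M where
  add_le_add_left x y h z := by
    obtain ⟨w, rfl⟩ := (model_le_iff x y).1 h
    exact (model_le_iff _ _).2 ⟨w, by ring⟩
  le_of_add_le_add_left x y z h := by
    obtain ⟨w, hw⟩ := (model_le_iff _ _).1 h
    exact (model_le_iff _ _).2 ⟨w, model_add_right_cancel _ _ x (by
      rw [add_right_comm, add_comm y, add_comm z, hw])⟩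

attribute [local instance] canonicallyOrderedAddOfModel isOrderedCancelAddMonoidOfModel

theorem model_lt_iff (x y : M) : x < y ↔ ∃ z, x + (z + 1) = y := by
  constructor
  · intro h
    obtain ⟨z, rfl⟩ := (model_le_iff x y).1 h.le
    rcases model_eq_zero_or_succ z with rfl | ⟨w, rfl⟩
    · simp at h
    · exact ⟨w, rfl⟩
  · rintro ⟨z, rfl⟩
    refine lt_of_le_of_ne le_self_add fun h => model_succ_ne_zero z ?_
    exact (left_eq_add.1 h)

theorem model_lt_add_one_iff (x y : M) : x < y + 1 ↔ x ≤ y := by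
  rw [model_lt_iff, model_le_iff]
  exact exists_congr fun z => by rw [← add_assoc, add_left_inj]

theorem model_mul_lt_mul_left (x y z : M) (h : y < z) (hx : 0 < x) : x * y < x * z := by
  obtain ⟨a, rfl⟩ := (model_lt_iff y z).1 h
  obtain ⟨b, rfl⟩ := (model_lt_iff 0 x).1 hx
  exact (model_lt_iff _ _).2 ⟨(b + 1) * a + b, by ring⟩

theorem isStrictOrderedRingOfModel : IsStrictOrderedRing M where
  zero_le_one := zero_le
  exists_pair_ne := ⟨0, 1, fun h => model_succ_ne_zero (0 : M) (by rw [zero_add, ← h])⟩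
  mul_lt_mul_of_pos_left x hx y z h := model_mul_lt_mul_left x y z h hx
  mul_lt_mul_of_pos_right x hx y z h := by
    simpa only [mul_comm] using model_mul_lt_mul_left x y z h hx

attribute [local instance] isStrictOrderedRingOfModel

theorem IsArith.lt {s t : (ℕ → M) → M} (hs : IsArithTerm s) (ht : IsArithTerm t) :
    IsArith fun v => s v < t v := by
  simpa only [not_le] using (IsArith.le ht hs).not

/-! ### Standard elements -/

/-- The standard elements form an initial segment of the model. -/
theorem exists_eq_natCast_of_le {n : ℕ} {x : M} (h : x ≤ n) : ∃ m : ℕ, x = m := by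
  induction n generalizing x with
  | zero => exact ⟨0, le_antisymm h (by simp)⟩
  | succ n ih =>
    rcases h.lt_or_eq with h | h
    · rw [Nat.cast_succ, model_lt_add_one_iff] at h
      exact ih h
    · exact ⟨n + 1, h⟩

theorem realize_numeral {α : Type*} (v : α → M) (n : ℕ) :
    (numeral n : LA.Term α).realize v = n := by
  induction n with
  | zero => rw [numeral, realize_zero, Nat.cast_zero]
  | succ n ih => rw [numeral, realize_add, realize_one, ih, Nat.cast_succ]

/-- If every element were standard, then `n ↦ n` would be an isomorphism from `ℕ`. -/
theorem exists_forall_natCast_lt (h : IsEmpty (LA.Equiv ℕ M)) : ∃ x : M, ∀ n : ℕ, (n : M) < x := by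
  by_contra! H
  have hsurj : Function.Surjective (Nat.cast : ℕ → M) := fun x => by
    obtain ⟨n, hn⟩ := H x
    obtain ⟨m, hm⟩ := exists_eq_natCast_of_le hn
    exact ⟨m, hm.symm⟩
  refine h.false
    { Equiv.ofBijective (Nat.cast : ℕ → M) ⟨Nat.cast_injective, hsurj⟩ with
      map_fun' := ?_
      map_rel' := ?_ }
  · have h₂ : ∀ v : Fin 2 → ℕ, ((↑) : ℕ → M) ∘ v = ![(v 0 : M), (v 1 : M)] := fun v => by
      ext i; fin_cases i <;> rfl
    rintro n (_ | _ | _ | _) v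
    · exact Nat.cast_zero.trans (congrArg (Structure.funMap (L := LA) ArithFunc.zero)
        (Subsingleton.elim _ _))
    · exact Nat.cast_one.trans (congrArg (Structure.funMap (L := LA) ArithFunc.one)
        (Subsingleton.elim _ _))
    · exact (Nat.cast_add _ _).trans (congrArg (Structure.funMap (L := LA) ArithFunc.add)
        (h₂ v).symm)
    · exact (Nat.cast_mul _ _).trans (congrArg (Structure.funMap (L := LA) ArithFunc.mul)
        (h₂ v).symm)
  · rintro n (_ | _) v
    have h₂ : ((↑) : ℕ → M) ∘ v = ![(v 0 : M), (v 1 : M)] := by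
      ext i; fin_cases i <;> rfl
    exact (iff_of_eq (congrArg (Structure.RelMap (L := LA) ArithRel.le) h₂)).trans
      (Nat.cast_le (α := M))

/-! ### Division with remainder -/

theorem model_exists_div (x m : M) (hm : 0 < m) : ∃ q r, r < m ∧ x = q * m + r := by
  refine arith_induction (P := fun x : M => ∀ m : M, 0 < m → ∃ q r, r < m ∧ x = q * m + r)
    (.all (.imp (.lt .zero (.var 0)) (.ex (.ex (.and (.lt (.var 0) (.var 2))
      (.eq (.var 3) (.add (.mul (.var 1) (.var 2)) (.var 0)))))))) ?_ ?_ x m hm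
  · exact fun m hm => ⟨0, 0, hm, by ring⟩
  · intro x ih m hm
    obtain ⟨q, r, hr, rfl⟩ := ih m hm
    obtain ⟨z, rfl⟩ := (model_lt_iff r m).1 hr
    rcases model_eq_zero_or_succ z with rfl | ⟨w, rfl⟩
    · exact ⟨q + 1, 0, hm, by ring⟩
    · exact ⟨q, r + 1, (model_lt_iff _ _).2 ⟨w, by ring⟩, by ring⟩

theorem model_div_unique {m q r q' r' : M} (hr : r < m) (hr' : r' < m)
    (h : q * m + r = q' * m + r') : q = q' ∧ r = r' := by
  have key : ∀ {q r q' r' : M}, r < m → q < q' → q * m + r < q' * m + r' := by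
    intro q r q' r' hr hq
    obtain ⟨z, rfl⟩ := (model_lt_iff _ _).1 hq
    calc q * m + r < q * m + m := by gcongr
      _ ≤ q * m + m + (z * m + r') := le_self_add
      _ = (q + (z + 1)) * m + r' := by ring
  have hq : q = q' := by
    rcases lt_trichotomy q q' with hq | hq | hq
    · exact absurd h (key hr hq).ne
    · exact hq
    · exact absurd h (key hr' hq).ne'
  subst hq
  exact ⟨rfl, add_left_cancel h⟩

/-! ### Representability of primitive recursive functions -/

/-- The graph `z = Nat.pair x y` of the pairing function, read in a model of `PA`. -/
def PairRel (x y z : M) : Prop :=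
  (x < y ∧ z = y * y + x) ∨ (y ≤ x ∧ z = x * x + x + y)

/-- The statement that `z` is the code of the pair `(x, y)`. The bounds `x ≤ z` and `y ≤ z` hold for
all natural numbers; they are part of the formula so that the components of a standard `z` are
visibly standard. -/
def UnpairRel (z x y : M) : Prop := x ≤ z ∧ y ≤ z ∧ PairRel x y z

/-- The statement `s % ((i + 1) * t + 1) = r`, that is, `r` is the `i`-th entry of the sequence
with Gödel code `(s, t)`, read in a model of `PA`. -/
def BetaRel (s t i r : M) : Prop :=
  r < (i + 1) * t + 1 ∧ ∃ q, s = q * ((i + 1) * t + 1) + r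

theorem pairRel_natCast (a b : ℕ) (z : M) : PairRel (a : M) b z ↔ z = (Nat.pair a b : ℕ) := by
  unfold PairRel Nat.pair
  by_cases h : a < b
  · simp [h, h.not_ge]
  · simp [h, not_lt.1 h]

theorem unpairRel_natCast (n : ℕ) (x y : M) :
    UnpairRel (n : M) x y ↔ x = (n.unpair.1 : ℕ) ∧ y = (n.unpair.2 : ℕ) := by
  constructor
  · rintro ⟨hx, hy, h⟩
    obtain ⟨a, rfl⟩ := exists_eq_natCast_of_le hx
    obtain ⟨b, rfl⟩ := exists_eq_natCast_of_le hy
    rw [pairRel_natCast, Nat.cast_inj] at h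
    subst h
    simp
  · rintro ⟨rfl, rfl⟩
    exact ⟨Nat.cast_le.2 n.unpair_left_le, Nat.cast_le.2 n.unpair_right_le, by
      rw [pairRel_natCast, Nat.pair_unpair]⟩

theorem BetaRel.unique {s t i r r' : M} (h : BetaRel s t i r) (h' : BetaRel s t i r') :
    r = r' := by
  obtain ⟨hr, q, rfl⟩ := h
  obtain ⟨hr', q', h⟩ := h'
  exact (model_div_unique hr hr' h).2

theorem betaRel_natCast (n i : ℕ) :
    BetaRel (n.unpair.1 : M) (n.unpair.2 : ℕ) i (Nat.beta n i : ℕ) := by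
  refine ⟨?_, ((n.unpair.1 / ((i + 1) * n.unpair.2 + 1) : ℕ) : M), ?_⟩
  · exact_mod_cast Nat.mod_lt _ (Nat.succ_pos _)
  · exact_mod_cast (Nat.div_add_mod' _ _).symm

/-- Gödel's lemma, transferred to a model: every finite sequence of natural numbers has a code. -/
theorem exists_betaRel (h : ℕ → ℕ) (k : ℕ) :
    ∃ s t : M, ∀ m ≤ k, BetaRel s t (m : M) (h m : ℕ) := by
  refine ⟨((Nat.unbeta ((List.range (k + 1)).map h)).unpair.1 : ℕ),
    ((Nat.unbeta ((List.range (k + 1)).map h)).unpair.2 : ℕ), fun m hm => ?_⟩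
  have hlen : m < ((List.range (k + 1)).map h).length := by simp; omega
  have e := Nat.beta_unbeta_coe ((List.range (k + 1)).map h) ⟨m, hlen⟩
  rw [Fin.getElem_fin, List.getElem_map, List.getElem_range] at e
  rw [← e]
  exact betaRel_natCast _ _

namespace IsArith

variable {s t u w : (ℕ → M) → M}

theorem pairRel (hs : IsArithTerm s) (ht : IsArithTerm t) (hu : IsArithTerm u) :
    IsArith fun v => PairRel (s v) (t v) (u v) :=
  .or (.and (.lt hs ht) (.eq hu (.add (.mul ht ht) hs)))
    (.and (.le ht hs) (.eq hu (.add (.add (.mul hs hs) hs) ht)))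

theorem unpairRel (hs : IsArithTerm s) (ht : IsArithTerm t) (hu : IsArithTerm u) :
    IsArith fun v => UnpairRel (s v) (t v) (u v) :=
  .and (.le ht hs) (.and (.le hu hs) (.pairRel ht hu hs))

theorem betaRel (hs : IsArithTerm s) (ht : IsArithTerm t) (hu : IsArithTerm u)
    (hw : IsArithTerm w) : IsArith fun v => BetaRel (s v) (t v) (u v) (w v) := by
  have h : IsArith fun v : ℕ → M => BetaRel (v 0) (v 1) (v 2) (v 3) :=
    .and (.lt (.var 3) (.add (.mul (.add (.var 2) .one) (.var 1)) .one))
      (.ex (.eq (.var 1) (.add (.mul (.var 0)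
        (.add (.mul (.add (.var 3) .one) (.var 2)) .one)) (.var 4))))
  exact h.subst (t := fun i => match i with
    | 0 => s | 1 => t | 2 => u | _ => w) fun i => by
      match i with
      | 0 => exact hs
      | 1 => exact ht
      | 2 => exact hu
      | _ + 3 => exact hw

end IsArith

variable (M) in
/-- `f : ℕ → ℕ` is representable in `M` if some parameter-free definable relation of `M` holds
between a standard `n` and an arbitrary, possibly non-standard, `y` exactly when `y = f n`. -/
def Representable (f : ℕ → ℕ) : Prop :=
  ∃ R : M → M → Prop, (IsArith fun v : ℕ → M => R (v 0) (v 1)) ∧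
    ∀ (n : ℕ) (y : M), R n y ↔ y = (f n : ℕ)

namespace Representable

theorem pair {f g : ℕ → ℕ} : Representable M f → Representable M g →
    Representable M fun n => Nat.pair (f n) (g n)
  | ⟨R, hR, hf⟩, ⟨S, hS, hg⟩ => by
    refine ⟨fun n z => ∃ x y, R n x ∧ S n y ∧ PairRel x y z,
      .ex (.ex (.and (hR.subst₂ (.var 2) (.var 1)) (.and (hS.subst₂ (.var 2) (.var 0))
        (.pairRel (.var 1) (.var 0) (.var 3))))), fun n z => ?_⟩
    simp [hf, hg, pairRel_natCast]

theorem comp {f g : ℕ → ℕ} : Representable M f → Representable M g →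
    Representable M fun n => f (g n)
  | ⟨R, hR, hf⟩, ⟨S, hS, hg⟩ => by
    refine ⟨fun n z => ∃ y, S n y ∧ R y z,
      .ex (.and (hS.subst₂ (.var 1) (.var 0)) (hR.subst₂ (.var 0) (.var 2))), fun n z => ?_⟩
    simp [hf, hg]

/-- Primitive recursion: the value is read off from a Gödel code of the sequence of all values.
The code may be non-standard, but its entries at standard places are determined by recursion. -/
theorem prec {f g : ℕ → ℕ} : Representable M f → Representable M g →
    Representable M (Nat.unpaired fun z n =>
      n.rec (f z) fun y IH => g (Nat.pair z (Nat.pair y IH)))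
  | ⟨R, hR, hf⟩, ⟨S, hS, hg⟩ => by
    refine ⟨fun n w => ∃ z k, UnpairRel n z k ∧ ∃ s t, (∃ a, R z a ∧ BetaRel s t 0 a) ∧
      (∀ i, i < k → ∀ r, BetaRel s t i r → ∃ p q r', PairRel i r p ∧ PairRel z p q ∧ S q r' ∧
        BetaRel s t (i + 1) r') ∧ BetaRel s t k w, ?_, fun n w => ?_⟩
    · exact .ex (.ex (.and (.unpairRel (.var 2) (.var 1) (.var 0)) (.ex (.ex (.and
        (.ex (.and (hR.subst₂ (.var 4) (.var 0)) (.betaRel (.var 2) (.var 1) .zero (.var 0))))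
        (.and (.all (.imp (.lt (.var 0) (.var 3)) (.all (.imp
          (.betaRel (.var 3) (.var 2) (.var 1) (.var 0))
          (.ex (.ex (.ex (.and (.pairRel (.var 4) (.var 3) (.var 2))
            (.and (.pairRel (.var 8) (.var 2) (.var 1)) (.and (hS.subst₂ (.var 1) (.var 0))
              (.betaRel (.var 6) (.var 5) (.add (.var 4) .one) (.var 0))))))))))))
          (.betaRel (.var 1) (.var 0) (.var 2) (.var 5))))))))
    · simp only [unpairRel_natCast]
      set z := n.unpair.1
      set k := n.unpair.2
      set h : ℕ → ℕ := fun m => m.rec (f z) fun y IH => g (Nat.pair z (Nat.pair y IH))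
      have hzero : h 0 = f z := rfl
      have hsucc : ∀ m, h (m + 1) = g (Nat.pair z (Nat.pair m (h m))) := fun m => rfl
      change _ ↔ w = (h k : ℕ)
      constructor
      · rintro ⟨_, _, ⟨rfl, rfl⟩, s, t, ⟨a, ha, h₀⟩, hs, hw⟩
        rw [hf] at ha
        subst ha
        -- By external induction, a code `(s, t)` accepted by the formula, standard or not, has the
        -- intended entries at standard places.
        have key : ∀ m : ℕ, m ≤ k → BetaRel s t (m : M) (h m : ℕ) := by
          intro m
          induction m with
          | zero => intro _; rwa [Nat.cast_zero, hzero]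
          | succ m ih =>
            intro hm
            obtain ⟨p, q, r', hp, hq, hr, hb⟩ := hs m (Nat.cast_lt.2 hm) _ (ih (by omega))
            rw [pairRel_natCast] at hp
            subst hp
            rw [pairRel_natCast] at hq
            subst hq
            rw [hg] at hr
            subst hr
            rw [hsucc, Nat.cast_succ]
            exact hb
        exact hw.unique (key k le_rfl)
      · rintro rfl
        obtain ⟨s, t, hb⟩ := exists_betaRel (M := M) h k
        refine ⟨_, _, ⟨rfl, rfl⟩, s, t, ⟨_, (hf _ _).2 rfl, ?_⟩, ?_,
          hb k le_rfl⟩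
        · rw [← hzero, ← Nat.cast_zero]
          exact hb 0 (Nat.zero_le _)
        intro i hi r hr
        obtain ⟨m, rfl⟩ := exists_eq_natCast_of_le hi.le
        rw [Nat.cast_lt] at hi
        obtain rfl := hr.unique (hb m hi.le)
        refine ⟨_, _, _, (pairRel_natCast _ _ _).2 rfl, (pairRel_natCast _ _ _).2 rfl,
          (hg _ _).2 rfl, ?_⟩
        rw [← hsucc, ← Nat.cast_succ]
        exact hb (m + 1) hi

/-- Every primitive recursive function is representable in every model of `PA`. -/
theorem of_primrec {f : ℕ → ℕ} (hf : Nat.Primrec f) : Representable M f := by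
  induction hf with
  | zero => exact ⟨fun _ y => y = 0, .eq (.var 1) .zero, by simp⟩
  | succ => exact ⟨fun x y => y = x + 1, .eq (.var 1) (.add (.var 0) .one), by simp⟩
  | left =>
    refine ⟨fun n x => ∃ y, UnpairRel n x y, .ex (.unpairRel (.var 1) (.var 2) (.var 0)), ?_⟩
    simp [unpairRel_natCast]
  | right =>
    refine ⟨fun n y => ∃ x, UnpairRel n x y, .ex (.unpairRel (.var 1) (.var 0) (.var 2)), ?_⟩
    simp [unpairRel_natCast]
  | pair _ _ hf hg => exact hf.pair hg
  | comp _ _ hf hg => exact hf.comp hg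
  | prec _ _ hf hg => exact hf.prec hg

end Representable

/-! ### Divisibility and primes in a model -/

theorem model_le_mul_right {x y : M} (hx : x ≠ 0) : y ≤ x * y := by
  rcases model_eq_zero_or_succ x with rfl | ⟨z, rfl⟩
  · exact absurd rfl hx
  · exact (model_le_iff _ _).2 ⟨z * y, by ring⟩

theorem natCast_dvd_natCast (m n : ℕ) : (m : M) ∣ n ↔ m ∣ n := by
  refine ⟨?_, Nat.cast_dvd_cast⟩
  rintro ⟨c, hc⟩
  rcases eq_or_ne m 0 with rfl | hm
  · rw [Nat.cast_zero, zero_mul, Nat.cast_eq_zero] at hc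
    rw [hc]
  · obtain ⟨d, rfl⟩ := exists_eq_natCast_of_le (n := n) (x := c) (by
      rw [hc]
      exact model_le_mul_right (Nat.cast_ne_zero.2 hm))
    exact ⟨d, by exact_mod_cast hc⟩

/-- A standard prime is prime in the model: reducing both factors modulo `p` turns a divisibility
in the model into one between natural numbers. -/
theorem prime_natCast {p : ℕ} (hp : p.Prime) : Prime (p : M) := by
  refine ⟨Nat.cast_ne_zero.2 hp.ne_zero, fun h => ?_, fun a b hab => ?_⟩
  · rw [isUnit_iff_dvd_one, ← Nat.cast_one, natCast_dvd_natCast] at h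
    exact hp.one_lt.ne' (Nat.dvd_one.1 h)
  · have hdvd : ∀ {q r : M}, (p : M) ∣ q * p + r ↔ (p : M) ∣ r := by
      intro q r
      refine ⟨?_, fun h => (dvd_mul_left _ _).add h⟩
      rintro ⟨c, hc⟩
      obtain ⟨q', r', hr', rfl⟩ := model_exists_div r p (Nat.cast_pos.2 hp.pos)
      obtain ⟨-, rfl⟩ := model_div_unique (q := q + q') (q' := c) hr'
        (Nat.cast_pos.2 hp.pos) (by rw [add_zero, mul_comm c, ← hc]; ring)
      rw [add_zero]
      exact dvd_mul_left _ _
    obtain ⟨q, r, hr, rfl⟩ := model_exists_div a p (Nat.cast_pos.2 hp.pos)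
    obtain ⟨q', r', hr', rfl⟩ := model_exists_div b p (Nat.cast_pos.2 hp.pos)
    obtain ⟨m, rfl⟩ := exists_eq_natCast_of_le hr.le
    obtain ⟨n, rfl⟩ := exists_eq_natCast_of_le hr'.le
    have e : (q * p + m) * (q' * p + n) = (q * p * q' + q * n + m * q') * p + m * n := by ring
    rw [e, hdvd, ← Nat.cast_mul, natCast_dvd_natCast, hp.dvd_mul] at hab
    rwa [hdvd, hdvd, natCast_dvd_natCast, natCast_dvd_natCast]

/-- If `k = p * r` with `k` prime, then `k` divides `p`, whence `k = p` by comparing sizes, or `k`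
divides `r`, whence `p` would be a unit. -/
theorem eq_of_prime_dvd_prime {p k : M} (hp : Prime p) (hk : Prime k) (h : p ∣ k) : p = k := by
  obtain ⟨r, hr⟩ := h
  rcases hk.dvd_or_dvd (dvd_of_eq hr) with ⟨s, hs⟩ | ⟨s, hs⟩
  · have h₁ : k ≤ p := by
      rw [hs, mul_comm]
      exact model_le_mul_right fun h => hp.ne_zero (by rw [hs, h, mul_zero])
    have h₂ : p ≤ k := by
      rw [hr, mul_comm]
      exact model_le_mul_right fun h => hk.ne_zero (by rw [hr, h, mul_zero])
    exact le_antisymm h₂ h₁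
  · have e : k * 1 = k * (p * s) := by
      rw [mul_one, mul_left_comm, ← hs, ← hr]
    have h1 : 1 = p * s := by
      rcases lt_trichotomy 1 (p * s) with h | h | h
      · exact absurd e (model_mul_lt_mul_left _ _ _ h (pos_iff_ne_zero.2 hk.ne_zero)).ne
      · exact h
      · exact absurd e (model_mul_lt_mul_left _ _ _ h (pos_iff_ne_zero.2 hk.ne_zero)).ne'
    exact absurd (isUnit_iff_dvd_one.2 ⟨s, h1⟩) hp.not_isUnit

namespace IsArith

variable {s t : (ℕ → M) → M}

theorem dvd (hs : IsArithTerm s) (ht : IsArithTerm t) : IsArith fun v => s v ∣ t v :=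
  have h : IsArith fun v : ℕ → M => v 0 ∣ v 1 :=
    .ex (.eq (.var 2) (.mul (.var 1) (.var 0)))
  h.subst₂ hs ht

theorem prime (hs : IsArithTerm s) : IsArith fun v => Prime (s v) := by
  have h : IsArith fun v : ℕ → M => Prime (v 0) := by
    simp only [Prime, isUnit_iff_dvd_one]
    exact .and (.not (.eq (.var 0) .zero)) (.and (.not (.dvd (.var 0) .one))
      (.all (.all (.imp (.dvd (.var 2) (.mul (.var 1) (.var 0)))
        (.or (.dvd (.var 2) (.var 1)) (.dvd (.var 2) (.var 0)))))))
  exact h.subst₁ hs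

end IsArith

/-! ### Coding definable sets by prime divisors -/

/-- Inside a model, every definable set of primes below a bound is the set of prime divisors of a
single element. -/
theorem exists_prime_dvd_iff {P : M → Prop} (hP : IsArith fun v : ℕ → M => P (v 0)) (k : M) :
    ∃ c : M, ∀ p, Prime p → (p ∣ c ↔ p < k ∧ P p) := by
  refine arith_induction (P := fun k : M => ∃ c : M, ∀ p, Prime p → (p ∣ c ↔ p < k ∧ P p))
    (.ex (.all (.imp (.prime (.var 0)) (.iff (.dvd (.var 0) (.var 1))
      (.and (.lt (.var 0) (.var 2)) (hP.subst₁ (.var 0))))))) ?_ ?_ k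
  · refine ⟨1, fun p hp => iff_of_false (fun h => ?_) fun h => not_lt_zero h.1⟩
    exact hp.not_isUnit (isUnit_iff_dvd_one.2 h)
  · rintro k ⟨c, hc⟩
    by_cases hk : Prime k ∧ P k
    · refine ⟨c * k, fun p hp => ?_⟩
      rw [hp.dvd_mul, hc p hp, model_lt_add_one_iff, le_iff_lt_or_eq]
      constructor
      · rintro (⟨h, h'⟩ | h)
        · exact ⟨Or.inl h, h'⟩
        · obtain rfl := eq_of_prime_dvd_prime hp hk.1 h
          exact ⟨Or.inr rfl, hk.2⟩
      · rintro ⟨h | rfl, h'⟩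
        · exact Or.inl ⟨h, h'⟩
        · exact Or.inr dvd_rfl
    · refine ⟨c, fun p hp => ?_⟩
      rw [hc p hp, model_lt_add_one_iff, le_iff_lt_or_eq]
      refine ⟨fun h => ⟨Or.inl h.1, h.2⟩, ?_⟩
      rintro ⟨h | rfl, h'⟩
      · exact ⟨h, h'⟩
      · exact absurd ⟨hp, h'⟩ hk

/-- An element of a model codes, through its standard prime divisors, the standard part of any set
definable without parameters, provided the model has an element above all standard ones. -/
theorem exists_prime_code {b : M} (hb : ∀ n : ℕ, (n : M) < b) {P : M → Prop}
    (hP : IsArith fun v : ℕ → M => P (v 0)) :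
    ∃ c : M, ∀ n : ℕ, ((Nat.nth Nat.Prime n : ℕ) : M) ∣ c ↔ P n := by
  obtain ⟨R, hR, hcount⟩ := Representable.of_primrec (M := M) primrec_count_prime
  -- `R` transports `P` from the index `n` to the prime `π n`, since `n` is the number of primes
  -- below `π n`.
  obtain ⟨c, hc⟩ := exists_prime_dvd_iff (P := fun p : M => ∃ n, R p n ∧ P n)
    (.ex (.and (hR.subst₂ (.var 1) (.var 0)) (hP.subst₁ (.var 0)))) b
  refine ⟨c, fun n => ?_⟩
  rw [hc _ (prime_natCast (Nat.nth_mem_of_infinite Nat.infinite_setOfPred_prime n))]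
  simp [hb, hcount, Nat.count_nth_of_infinite Nat.infinite_setOfPred_prime]

/-! ### A definable set separating two inseparable sets -/

/-- Rosser's trick: the formula `∃ z, T(n, z) = 1 ∧ ∀ w ≤ z, T(n, w) ≠ 2` holds in the model at
every standard `n` with `T (pair n z) = 1` for a standard `z`, and fails at every standard `n` with
`T (pair n w) = 2` for a standard `w`. -/
theorem exists_separating_formula {T : ℕ → ℕ} (hT : Nat.Primrec T)
    (hdisj : ∀ n z w, T (Nat.pair n z) = 1 → T (Nat.pair n w) ≠ 2) :
    ∃ P : M → Prop, (IsArith fun v : ℕ → M => P (v 0)) ∧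
      (∀ n z : ℕ, T (Nat.pair n z) = 1 → P n) ∧ ∀ n z : ℕ, T (Nat.pair n z) = 2 → ¬ P n := by
  obtain ⟨R, hR, hrep⟩ := Representable.of_primrec (M := M) hT
  obtain ⟨S, h₁, h₂, hS⟩ : ∃ S : M → M → M → Prop,
      (IsArith fun v : ℕ → M => S (v 0) (v 1) 1) ∧
      (IsArith fun v : ℕ → M => S (v 0) (v 1) (1 + 1)) ∧
      ∀ (n z : ℕ) (y : M), S n z y ↔ y = (T (Nat.pair n z) : ℕ) :=
    ⟨fun n z y => ∃ q, PairRel n z q ∧ R q y,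
      .ex (.and (.pairRel (.var 1) (.var 2) (.var 0)) (hR.subst₂ (.var 0) .one)),
      .ex (.and (.pairRel (.var 1) (.var 2) (.var 0)) (hR.subst₂ (.var 0) (.add .one .one))),
      fun n z y => by simp [pairRel_natCast, hrep]⟩
  have h_two : (1 : M) + 1 = (2 : ℕ) := by norm_num
  refine ⟨fun n => ∃ z, S n z 1 ∧ ∀ w, w ≤ z → ¬ S n w (1 + 1),
    .ex (.and (h₁.subst₂ (R := fun n z => S n z 1) (.var 1) (.var 0))
      (.all (.imp (.le (.var 0) (.var 1)) (.not (h₂.subst₂ (R := fun n w => S n w (1 + 1))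
        (.var 2) (.var 0)))))),
    fun n z hz => ?_, fun n w hw => ?_⟩
  · refine ⟨z, (hS n z 1).2 (by rw [hz, Nat.cast_one]), fun w hwz => ?_⟩
    obtain ⟨w, rfl⟩ := exists_eq_natCast_of_le hwz
    rw [hS, h_two, Nat.cast_inj]
    exact (hdisj n z w hz).symm
  · rintro ⟨z, hz, hzw⟩
    -- A witness `z ≤ w` is standard, so that it contradicts the disjointness.
    rcases le_total (w : M) z with h | h
    · exact hzw w h ((hS n w _).2 (by rw [hw, h_two]))
    · obtain ⟨z, rfl⟩ := exists_eq_natCast_of_le h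
      rw [hS, ← Nat.cast_one, Nat.cast_inj] at hz
      exact hdisj n z w hz.symm hw

/-! ### Coded sets and the standard system -/

theorem mem_codedSet_iff (n : ℕ) (c : M) :
    n ∈ codedSet c ↔ ((Nat.nth Nat.Prime n : ℕ) : M) ∣ c := by
  simp only [codedSet, Satisfies, dividesFormula, Set.mem_ofPred_eq, Formula.Realize,
    BoundedFormula.realize_ex, BoundedFormula.realize_bdEqual, realize_mul, realize_numeral]
  exact exists_congr fun k => by rw [mul_comm]; rfl

/-- The standard part of a set definable without parameters is in the standard system. -/
theorem setOf_natCast_mem_SSy {P : M → Prop} (hP : IsArith fun v : ℕ → M => P (v 0)) :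
    {n : ℕ | P n} ∈ SSy M := by
  obtain ⟨φ, h⟩ := hP
  -- The formula ignores its parameter, so that any element of `M` serves as one.
  refine ⟨Formula.relabel (fun _ => (0 : Fin 2)) φ, 0, ?_⟩
  ext n
  rw [Set.mem_ofPred_eq, Set.mem_ofPred_eq, Satisfies, Formula.realize_relabel, h, realize_numeral]
  rfl

end Interpretation

end PeanoArithmetic

theorem theorem7 (M : Type*) [PeanoArithmetic.LA.Structure M]
    (hM : PeanoArithmetic.IsNonstandardModel M) :
    ∃ C ∈ PeanoArithmetic.SSy M,
      ¬ ComputablePred (fun n : ℕ => n ∈ C) ∧ ∃ c : M, C = PeanoArithmetic.codedSet c := by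
  obtain ⟨hPA, hiso⟩ := hM
  obtain ⟨b, hb⟩ := PeanoArithmetic.exists_forall_natCast_lt hiso
  obtain ⟨T, hT, hdisj, hinsep⟩ := PeanoArithmetic.exists_primrec_inseparable
  obtain ⟨P, hP, h₁, h₂⟩ := PeanoArithmetic.exists_separating_formula (M := M) hT hdisj
  obtain ⟨c, hc⟩ := PeanoArithmetic.exists_prime_code hb hP
  refine ⟨_, PeanoArithmetic.setOf_natCast_mem_SSy hP, hinsep _ h₁ h₂, c, Set.ext fun n => ?_⟩
  rw [PeanoArithmetic.mem_codedSet_iff, hc, Set.mem_ofPred_eq]
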